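/- **Notions.** For an infinite set $\mathbb P$ of propositional variables, modal formulas over $\mathbb P$ are built with $\neg,\wedge,\Box$ (with $\varphi\to\psi:=\neg(\varphi\wedge\neg\psi)$ and $\Diamond\varphi:=\neg\Box\neg\varphi$). $\mathsf{GL}(\mathbb P)$ is axiomatized by all propositional tautologies, $\Box(\varphi\to\psi)\to(\Box\varphi\to\Box\psi)$ and $\Box(\Box\varphi\to\varphi)\to\Box\varphi$, with the rules modus ponens and necessitation. A set $\Gamma$ of formulas is consistent if no contradiction follows in $\mathsf{GL}(\mathbb P)$ from finitely many members of $\Gamma$. In a topological model on a space $X$ the Boolean connectives are interpreted classically and $[\![\Diamond\varphi]\!]=d[\![\varphi]\!]$ is the set of limit points of $[\![\varphi]\!]$. $\Gamma$ is satisfiable on $X$ if for some valuation there is a point of $X$ at which all members of $\Gamma$ are true. $\mathsf{GL}(\mathbb P)$ is strongly complete with respect to a class of spaces if every consistent set of formulas is satisfiable on some space of the class. For an ordinal $x\neq 0$ let $\ell(x)$ be the unique $\beta$ with $x=\alpha+\omega^\beta$ for some $\alpha$, and let $\ell(0)=0$. The hyperlogarithms $(\ell^\xi)_{\xi\in\mathrm{Ord}}$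 are the unique family of initial functions on the ordinals (functions mapping initial segments onto initial segments) such that $\ell^1=\ell$, $\ell^{\alpha+\beta}=\ell^\beta\circ\ell^\alpha$, and, for each $\zeta$, $\ell^\zeta$ is pointwise at least $f^\zeta$ for every family $(f^\xi)$ of initial functions with these two properties that satisfies $f^\xi=\ell^\xi$ for all $\xi<\zeta$. Let $(X,\tau)$ be a scattered space, let $\rho_\tau x$ be the Cantor–Bendixson rank of $x$, i.e. the least $\xi$ with $x\notin d^{\xi+1}X$, and let $\rho_\tau X=\sup_{x\in X}(\rho_\tau x+1)$. For an ordinal $\lambda$, the generalized Icard topology $\tau_{+\lambda}$ is the least topology containing $\tau$ and all sets $\{x\in X:\alpha<\ell^\xi\rho_\tau x\le\beta\}$ with $-1\le\alpha<\beta\le\rho_\tau X$ and $\xi<\lambda$. On an ordinal $\Theta=\{\alpha:\alpha<\Theta\}$ let $\mathcal I_0$ be the topology generated by the sets $[0,\beta]$ and let $\mathcal I_\lambda=(\mathcal I_0)_{+\lambda}$. Let $\tau_c$ be the club topology: points of cofinality $\le\omega$ are isolated, and the neighbourhoods of a point $\alpha$ with $\mathrm{cf}(\alpha)>\omega$ are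 the sets that contain $\alpha$ and a closed unbounded subset of $\alpha$. **Theorem.** Let $\lambda$ be any ordinal and $\kappa=|\lambda|+\aleph_0$. Let $\mathbb P=\{p_i: i<(2^\kappa)^+\}$ be a set of propositional variables with $|\mathbb P|=(2^\kappa)^+$ (the $p_i$ being distinct), and let $$\Gamma=\{\Diamond p_i : i<(2^\kappa)^+\}\cup\{\Box(p_i\to\Diamond p_j) : i<j<(2^\kappa)^+\}.$$ Then $\Gamma$ is consistent, but for no ordinal $\Theta$ is $\Gamma$ satisfiable on $(\Theta,\mathcal I_\lambda)$ or on $(\Theta,(\tau_c)_{+\lambda})$. Consequently $\mathsf{GL}(\mathbb P)$ is not strongly complete with respect to any class of spaces of the form $(\Theta,\mathcal I_\lambda)$ or $(\Theta,(\tau_c)_{+\lambda})$, in particular with respect to any single such space. -/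

import Mathlib

universe u v w

open Ordinal Cardinal

/-- The end logarithm `ℓ`: for `x ≠ 0`, the unique `b` such that `x = a + ω ^ b` for some `a`;
and `ℓ 0 = 0` (the infimum of the empty set). -/
noncomputable def endLog (x : Ordinal.{u}) : Ordinal.{u} :=
  sInf {b | ∃ a, x = a + ω ^ b}

/-- Initial functions: they map initial segments of the ordinals onto initial segments. -/
def IsInitialFun (f : Ordinal.{u} → Ordinal.{u}) : Prop :=
  ∀ a, ∃ b, f '' Set.Iio a = Set.Iio b

/-- Families of initial functions that iterate `ℓ` additively in the exponent. -/
structure IsLogFamily (g : Ordinal.{u} → Ordinal.{u} → Ordinal.{u}) : Prop where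
  initial : ∀ ξ, IsInitialFun (g ξ)
  one : g 1 = endLog
  add : ∀ a b, g (a + b) = g b ∘ g a

/-- The hyperlogarithms: the maximal such family. Maximality is taken stage by stage: `L ζ` is
pointwise maximal among the possible continuations of `(L ξ)_{ξ < ζ}`.  (It only has content
at additively indecomposable `ζ > 1`, the other stages being forced by additivity.  A family that
is pointwise maximal at all stages simultaneously does not exist, as the functions involved are
not monotone.) -/
structure IsHyperlog (L : Ordinal.{u} → Ordinal.{u} → Ordinal.{u}) : Prop
    extends IsLogFamily L where
  maximal : ∀ (ζ : Ordinal.{u}) (g : Ordinal.{u} → Ordinal.{u} → Ordinal.{u}), IsLogFamily g →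
    (∀ ξ < ζ, g ξ = L ξ) → ∀ α, g ζ α ≤ L ζ α

theorem isInitialFun_iff {f : Ordinal.{u} → Ordinal.{u}} :
    IsInitialFun f ↔ ∀ a, ∀ d < f a, ∃ b < a, f b = d := by
  constructor
  · intro hf a d hd
    obtain ⟨b, hb⟩ := hf (a + 1)
    obtain ⟨c, hc⟩ := hf a
    have h1 : f a ∈ Set.Iio b := hb ▸ ⟨a, by simp, rfl⟩
    have h2 : d ∈ f '' Set.Iio (a + 1) := hb ▸ (hd.trans h1)
    obtain ⟨e, he, rfl⟩ := h2
    have he' : e ≤ a := by simpa using he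
    rcases he'.lt_or_eq with h | rfl
    · exact ⟨e, h, rfl⟩
    · exact absurd hd (lt_irrefl _)
  · intro hf a
    have hne : ∃ b, b ∉ f '' Set.Iio a := by
      by_contra h
      push Not at h
      obtain ⟨c, hc⟩ := (bddAbove_of_small : BddAbove (f '' Set.Iio a))
      exact absurd (hc (h (c + 1))) (by simp)
    refine ⟨sInf {b | b ∉ f '' Set.Iio a}, ?_⟩
    ext d
    constructor
    · rintro ⟨e, he, rfl⟩
      by_contra h
      have h : sInf {b | b ∉ f '' Set.Iio a} ≤ f e := not_lt.1 h
      have hm := csInf_mem (s := {b | b ∉ f '' Set.Iio a}) hne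
      rcases h.lt_or_eq with h | h
      · obtain ⟨b, hb, hb'⟩ := hf e _ h
        exact hm ⟨b, hb.trans he, hb'⟩
      · exact hm ⟨e, he, h.symm⟩
    · intro h
      by_contra h'
      exact notMem_of_lt_csInf (s := {b | b ∉ f '' Set.Iio a}) h (OrderBot.bddBelow _) h'

theorem IsInitialFun.le {f : Ordinal.{u} → Ordinal.{u}} (hf : IsInitialFun f) (a : Ordinal.{u}) :
    f a ≤ a := by
  induction a using WellFoundedLT.induction with
  | _ a ih =>
    by_contra h
    obtain ⟨b, hb, hb'⟩ := isInitialFun_iff.1 hf a a (not_le.1 h)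
    exact absurd (ih b hb) (by simpa [hb'] using hb)

theorem exists_eq_add_opow {x : Ordinal.{u}} (hx : x ≠ 0) : ∃ b a : Ordinal.{u}, x = a + ω ^ b := by
  induction x using WellFoundedLT.induction with
  | _ x ih =>
    by_cases hp : IsPrincipal (· + ·) x
    · rcases isPrincipal_add_iff_zero_or_omega0_opow.1 hp with h | ⟨b, rfl⟩
      · exact absurd h hx
      · exact ⟨b, 0, by simp⟩
    · obtain ⟨b, hb, c, hc, rfl⟩ := exists_lt_add_of_not_isPrincipal_add hp
      have hc0 : c ≠ 0 := by
        rintro rfl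
        simp at hb
      obtain ⟨e, a, rfl⟩ := ih c hc hc0
      exact ⟨e, b + a, by rw [add_assoc]⟩

theorem endLog_spec {x : Ordinal.{u}} (hx : x ≠ 0) : ∃ a, x = a + ω ^ endLog x :=
  csInf_mem (s := {b | ∃ a, x = a + ω ^ b}) (exists_eq_add_opow hx)

theorem endLog_zero : endLog (0 : Ordinal.{u}) = 0 := by
  have : {b : Ordinal.{u} | ∃ a, (0 : Ordinal.{u}) = a + ω ^ b} = ∅ := by
    ext b
    simp only [Set.mem_ofPred_eq, Set.mem_empty_iff_false, iff_false, not_exists]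
    intro a h
    have : (0 : Ordinal.{u}) < ω ^ b := opow_pos _ omega0_pos
    exact absurd h.symm (this.trans_le le_add_self).ne'
  rw [endLog, this, Ordinal.sInf_empty]

/-- The exponent of the last term is unique. -/
theorem endLog_add_opow (a b : Ordinal.{u}) : endLog (a + ω ^ b) = b := by
  have key : ∀ a b a' b' : Ordinal.{u}, a + ω ^ b = a' + ω ^ b' → ¬ b < b' := by
    intro a b a' b' h hlt
    have h0 : (0 : Ordinal.{u}) < ω ^ b := opow_pos _ omega0_pos
    have hbb : (ω : Ordinal.{u}) ^ b < ω ^ b' := (opow_lt_opow_iff_right one_lt_omega0).2 hlt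
    have h1 : a < a' + ω ^ b' := h ▸ (lt_add_iff_pos_right a).2 h0
    rcases lt_or_ge a a' with h2 | h2
    · have := add_lt_add_of_le_of_lt h2.le hbb
      exact absurd h this.ne
    · obtain ⟨c, rfl⟩ : ∃ c, a = a' + c := ⟨a - a', (Ordinal.add_sub_cancel_of_le h2).symm⟩
      have hc : c < ω ^ b' := (add_lt_add_iff_left a').1 h1
      have := isPrincipal_add_omega0_opow b' hc hbb
      rw [add_assoc] at h
      exact absurd (add_left_cancel h) this.ne
  have h0 : (0 : Ordinal.{u}) < ω ^ b := opow_pos _ omega0_pos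
  obtain ⟨a', h⟩ := endLog_spec (x := a + ω ^ b) (h0.trans_le le_add_self).ne'
  exact le_antisymm (not_lt.1 (key _ _ _ _ h)) (not_lt.1 (key _ _ _ _ h.symm))

theorem isInitialFun_endLog : IsInitialFun endLog.{u} := by
  rw [isInitialFun_iff]
  intro a d hd
  have ha : a ≠ 0 := by
    rintro rfl
    rw [endLog_zero] at hd
    exact absurd hd (not_lt_bot)
  obtain ⟨c, hc⟩ := endLog_spec ha
  refine ⟨ω ^ d, ?_, by simpa using endLog_add_opow 0 d⟩
  calc ω ^ d < ω ^ endLog a := (opow_lt_opow_iff_right one_lt_omega0).2 hd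
    _ ≤ c + ω ^ endLog a := le_add_self
    _ = a := hc.symm

/-- One stage of the recursion: the value that a first drop below `α` at exponent `ξ` would
have, `F β` being the values already known for `β < α`. -/
noncomputable def hyperlogDrop (α : Ordinal.{u}) (F : ∀ β < α, Ordinal.{u} → Ordinal.{u})
    (ξ : Ordinal.{u}) : Ordinal.{u} :=
  open Classical in
  if ξ = 1 then endLog α
  else if 1 < ξ ∧ IsPrincipal (· + ·) ξ then ⨆ β : Set.Iio α, (F β.1 β.2 ξ + 1)
  else α

theorem exists_hyperlog_recursion : ∃ L : Ordinal.{u} → Ordinal.{u} → Ordinal.{u}, ∀ α,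
    (∀ η, hyperlogDrop α (fun β _ ξ => L ξ β) η < α →
      (∀ ξ < η, ¬ hyperlogDrop α (fun β _ ξ => L ξ β) ξ < α) →
      (∀ ξ < η, L ξ α = α) ∧
        ∀ ξ, L (η + ξ) α = L ξ (hyperlogDrop α (fun β _ ξ => L ξ β) η)) ∧
    ((∀ η, ¬ hyperlogDrop α (fun β _ ξ => L ξ β) η < α) → ∀ ξ, L ξ α = α) := by
  classical
  let step : ∀ α : Ordinal.{u}, (∀ β < α, Ordinal.{u} → Ordinal.{u}) → Ordinal.{u} → Ordinal.{u} :=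
    fun α F ξ =>
      if h : ∃ η, hyperlogDrop α F η < α then
        if ξ < sInf {η | hyperlogDrop α F η < α} then α
        else F (hyperlogDrop α F (sInf {η | hyperlogDrop α F η < α}))
          (csInf_mem (s := {η | hyperlogDrop α F η < α}) h)
          (ξ - sInf {η | hyperlogDrop α F η < α})
      else α
  let M : Ordinal.{u} → Ordinal.{u} → Ordinal.{u} := WellFoundedLT.fix step
  have hM : ∀ α, M α = step α (fun β _ => M β) := fun α => WellFoundedLT.fix_eq step α
  refine ⟨fun ξ α => M α ξ, fun α => ⟨fun η hη hmin => ?_, fun hno ξ => ?_⟩⟩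
  · change hyperlogDrop α (fun β _ => M β) η < α at hη
    change ∀ ξ < η, ¬ hyperlogDrop α (fun β _ => M β) ξ < α at hmin
    have he : sInf {η | hyperlogDrop α (fun β _ => M β) η < α} = η := by
      refine le_antisymm (csInf_le' hη) (le_csInf ⟨η, hη⟩ fun ξ hξ => ?_)
      by_contra h
      exact hmin ξ (not_le.1 h) hξ
    constructor
    · intro ξ hξ
      change M α ξ = α
      rw [hM]
      simp only [step]
      rw [dif_pos ⟨η, hη⟩, if_pos (he.symm ▸ hξ)]
    · intro ξ
      change M α (η + ξ) = M (hyperlogDrop α (fun β _ => M β) η) ξ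
      rw [hM α]
      simp only [step]
      rw [dif_pos ⟨η, hη⟩, if_neg (by rw [he]; simp)]
      simp only [he]
      rw [Ordinal.add_sub_cancel]
  · change M α ξ = α
    rw [hM]
    simp only [step]
    rw [dif_neg]
    rintro ⟨η, hη⟩
    exact hno η hη

theorem exists_isHyperlog : ∃ L : Ordinal.{u} → Ordinal.{u} → Ordinal.{u}, IsHyperlog L := by
  obtain ⟨L, hL⟩ := exists_hyperlog_recursion.{u}
  set T : Ordinal.{u} → Ordinal.{u} → Ordinal.{u} :=
    fun α => hyperlogDrop α (fun β _ ξ => L ξ β) with hT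
  have hT1 : ∀ α, T α 1 = endLog α := fun α => by simp [hT, hyperlogDrop]
  have hTp : ∀ α ξ, 1 < ξ → IsPrincipal (· + ·) ξ → T α ξ = ⨆ β : Set.Iio α, (L ξ β + 1) :=
    fun α ξ h1 h2 => by simp [hT, hyperlogDrop, h1, h1.ne', h2]
  have hTlt : ∀ α ξ, T α ξ < α → ξ = 1 ∨ (1 < ξ ∧ IsPrincipal (· + ·) ξ) := by
    intro α ξ h
    by_contra h'
    push Not at h'
    simp only [hT, hyperlogDrop] at h
    rw [if_neg h'.1, if_neg (by simpa using h'.2)] at h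
    exact lt_irrefl _ h
  -- case distinction: either a first drop exists, or everything is fixed
  have cases : ∀ α, (∃ η, T α η < α ∧ IsPrincipal (· + ·) η ∧ 0 < η ∧ (∀ ξ < η, ¬ T α ξ < α) ∧
      (∀ ξ < η, L ξ α = α) ∧ ∀ ξ, L (η + ξ) α = L ξ (T α η)) ∨
      ((∀ η, ¬ T α η < α) ∧ ∀ ξ, L ξ α = α) := by
    intro α
    by_cases h : ∃ η, T α η < α
    · left
      have h1 := csInf_mem (s := {η | T α η < α}) h
      have h2 : ∀ ξ < sInf {η | T α η < α}, ¬ T α ξ < α := fun ξ hξ h' =>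
        notMem_of_lt_csInf hξ (OrderBot.bddBelow _) h'
      obtain ⟨h3, h4⟩ := (hL α).1 _ h1 h2
      refine ⟨_, h1, ?_, ?_, h2, h3, h4⟩
      · rcases hTlt _ _ h1 with h | h
        · rw [h]; exact isPrincipal_add_one
        · exact h.2
      · rcases hTlt _ _ h1 with h | h
        · rw [h]; exact one_pos
        · exact one_pos.trans h.1
    · right
      push Not at h
      exact ⟨fun η => not_lt.2 (h η), (hL α).2 fun η => not_lt.2 (h η)⟩
  have zero : ∀ α, L 0 α = α := by
    intro α
    rcases cases α with ⟨η, -, -, h0, -, h, -⟩ | ⟨-, h⟩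
    · exact h 0 h0
    · exact h 0
  have le : ∀ α ξ, L ξ α ≤ α := by
    intro α
    induction α using WellFoundedLT.induction with
    | _ α ih =>
      intro ξ
      rcases cases α with ⟨η, hη, -, -, -, h1, h2⟩ | ⟨-, h⟩
      · rcases lt_or_ge ξ η with h | h
        · exact (h1 ξ h).le
        · rw [← Ordinal.add_sub_cancel_of_le h, h2]
          exact (ih _ hη _).trans hη.le
      · exact (h ξ).le
  have one : L 1 = endLog := by
    funext α
    rcases cases α with ⟨η, hη, -, h0, hmin, h1, h2⟩ | ⟨hno, h⟩
    · rcases hTlt _ _ hη with rfl | h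
      · have := h2 0
        rw [add_zero, zero, hT1] at this
        exact this
      · rw [h1 1 h.1]
        have := hmin 1 h.1
        rw [hT1] at this
        exact le_antisymm (not_lt.1 this) (isInitialFun_endLog.le α)
    · rw [h 1]
      have := hno 1
      rw [hT1] at this
      exact le_antisymm (not_lt.1 this) (isInitialFun_endLog.le α)
  have add : ∀ α a b, L (a + b) α = L b (L a α) := by
    intro α
    induction α using WellFoundedLT.induction with
    | _ α ih =>
      intro a b
      rcases cases α with ⟨η, hη, hp, -, -, h1, h2⟩ | ⟨-, h⟩
      · rcases lt_or_ge a η with ha | ha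
        · rw [h1 a ha]
          rcases lt_or_ge b η with hb | hb
          · rw [h1 b hb, h1 _ (hp ha hb)]
          · rw [hp.add_eq_right_of_le ha hb]
        · rw [← Ordinal.add_sub_cancel_of_le ha, add_assoc, h2, h2, ih _ hη]
      · rw [h a, h, h]
  have sup_ge : ∀ α ξ, 1 < ξ → IsPrincipal (· + ·) ξ → T α ξ ≤ α := by
    intro α ξ h1 h2
    rw [hTp α ξ h1 h2]
    exact Ordinal.iSup_le fun β => Order.add_one_le_of_lt ((le _ _).trans_lt β.2)
  -- the three possible values at a principal exponent
  have princ : ∀ α ξ, 1 < ξ → IsPrincipal (· + ·) ξ →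
      (∃ η < ξ, L η α < α ∧ η + ξ = ξ ∧ L ξ α = L ξ (L η α)) ∨
      L ξ α = ⨆ β : Set.Iio α, (L ξ β + 1) := by
    intro α ξ hξ1 hξp
    rcases cases α with ⟨η, hη, hp, h0, hmin, h1, h2⟩ | ⟨hno, h⟩
    · rcases lt_trichotomy η ξ with h | rfl | h
      · left
        have e : L η α = T α η := by simpa [zero] using h2 0
        refine ⟨η, h, e ▸ hη, hξp.add_eq_right h, ?_⟩
        rw [e, ← h2, hξp.add_eq_right h]
      · right
        rw [← hTp α _ hξ1 hξp]
        simpa [zero] using h2 0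
      · right
        rw [← hTp α _ hξ1 hξp, h1 ξ h]
        exact le_antisymm (not_lt.1 (hmin ξ h)) (sup_ge _ _ hξ1 hξp)
    · right
      rw [← hTp α _ hξ1 hξp, h ξ]
      exact le_antisymm (not_lt.1 (hno ξ)) (sup_ge _ _ hξ1 hξp)
  have small : ∀ ξ : Ordinal.{u}, ¬ 1 < ξ → ξ = 0 ∨ ξ = 1 := fun ξ h => Order.le_one_iff.1 (not_lt.1 h)
  have init : ∀ ξ α, ∀ δ < L ξ α, ∃ β < α, L ξ β = δ := by
    intro ξ
    induction ξ using WellFoundedLT.induction with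
    | _ ξ ihξ =>
      by_cases hp : IsPrincipal (· + ·) ξ
      · by_cases hξ1 : 1 < ξ
        · intro α
          induction α using WellFoundedLT.induction with
          | _ α ih =>
            intro δ hδ
            rcases princ α ξ hξ1 hp with ⟨η, -, hlt, -, he⟩ | he
            · rw [he] at hδ
              obtain ⟨β, hβ, rfl⟩ := ih _ hlt δ hδ
              exact ⟨β, hβ.trans hlt, rfl⟩
            · rw [he, Ordinal.lt_iSup_iff] at hδ
              obtain ⟨β, hβ⟩ := hδ
              rcases (Order.lt_add_one_iff.1 hβ).lt_or_eq with h | h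
              · obtain ⟨β', hβ', rfl⟩ := ih β.1 β.2 δ h
                exact ⟨β', hβ'.trans β.2, rfl⟩
              · exact ⟨β.1, β.2, h.symm⟩
        · rcases small ξ hξ1 with rfl | rfl
          · intro α δ hδ
            rw [zero] at hδ
            exact ⟨δ, hδ, zero δ⟩
          · rw [one]
            exact isInitialFun_iff.1 isInitialFun_endLog
      · obtain ⟨b, hb, c, hc, rfl⟩ := exists_lt_add_of_not_isPrincipal_add hp
        intro α δ hδ
        rw [add] at hδ
        obtain ⟨γ, hγ, rfl⟩ := ihξ c hc _ _ hδ
        obtain ⟨β, hβ, rfl⟩ := ihξ b hb _ _ hγ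
        exact ⟨β, hβ, add _ _ _⟩
  refine ⟨L, ⟨⟨fun ξ => isInitialFun_iff.2 (init ξ), one, fun a b => funext fun α => add α a b⟩,
    ?_⟩⟩
  intro ζ g hg hgL
  by_cases hp : IsPrincipal (· + ·) ζ
  · by_cases hζ1 : 1 < ζ
    · intro α
      induction α using WellFoundedLT.induction with
      | _ α ih =>
        rcases princ α ζ hζ1 hp with ⟨η, hη, hlt, hab, he⟩ | he
        · rw [he]
          calc g ζ α = g (η + ζ) α := by rw [hab]
            _ = g ζ (L η α) := by rw [hg.add, Function.comp, hgL η hη]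
            _ ≤ _ := ih _ hlt
        · rw [he]
          by_contra h
          obtain ⟨β, hβ, hβ'⟩ := isInitialFun_iff.1 (hg.initial ζ) α _ (not_le.1 h)
          have h1 := ih β hβ
          rw [hβ'] at h1
          have h2 := Ordinal.le_iSup (fun β : Set.Iio α => L ζ β + 1) ⟨β, hβ⟩
          exact absurd (Order.lt_add_one_iff.2 le_rfl) (not_lt.2 (h2.trans h1))
    · intro α
      rcases small ζ hζ1 with rfl | rfl
      · rw [zero]
        exact (hg.initial 0).le α
      · rw [hg.one, one]
  · obtain ⟨b, hb, c, hc, rfl⟩ := exists_lt_add_of_not_isPrincipal_add hp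
    intro α
    rw [hg.add, add, Function.comp, hgL b hb, hgL c hc]

/-- There is exactly one family of hyperlogarithms. -/
theorem existsUnique_isHyperlog :
    ∃! L : Ordinal.{u} → Ordinal.{u} → Ordinal.{u}, IsHyperlog L := by
  obtain ⟨L, hL⟩ := exists_isHyperlog.{u}
  refine ⟨L, hL, fun M hM => ?_⟩
  funext ζ
  induction ζ using WellFoundedLT.induction with
  | _ ζ ih =>
    funext α
    exact le_antisymm (hL.maximal ζ M hM.toIsLogFamily ih α)
      (hM.maximal ζ L hL.toIsLogFamily (fun ξ hξ => (ih ξ hξ).symm) α)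

/-- The hyperlogarithms `hyperlog ξ = ℓ^ξ`. -/
noncomputable def hyperlog : Ordinal.{u} → Ordinal.{u} → Ordinal.{u} :=
  existsUnique_isHyperlog.choose

theorem isHyperlog_hyperlog : IsHyperlog hyperlog.{u} :=
  existsUnique_isHyperlog.choose_spec.1

/-! ### Ranks, generalized Icard topologies, and topologies on ordinals -/

/-- The transfinite iteration `d^ξ A` of the derived set operator of `τ`. -/
noncomputable def iterDerived {X : Type v} (τ : TopologicalSpace X) (A : Set X)
    (ξ : Ordinal.{u}) : Set X :=
  Ordinal.limitRecOn ξ A (fun _ D => @derivedSet X τ D) (fun o _ D => ⋂ η : Set.Iio o, D η.1 η.2)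

/-- The rank of a point: the least `ξ` with `x ∉ d^{ξ+1} X`. -/
noncomputable def pointRank {X : Type v} (τ : TopologicalSpace X) (x : X) : Ordinal.{u} :=
  sInf {ξ | x ∉ iterDerived τ Set.univ (ξ + 1)}

/-- The rank of a scattered space: the supremum of all `ρ x + 1`. -/
noncomputable def spaceRank {X : Type v} (τ : TopologicalSpace X) : Ordinal.{u} :=
  ⨆ x, (pointRank τ x + 1)

/-- The set `(a, b]_ξ = {x | a < ℓ^ξ (ρ x) ≤ b}`; here `a = ⊥` plays the role of `-1`. -/
def icardInterval {X : Type v} (τ : TopologicalSpace X) (ξ : Ordinal.{u})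
    (a : WithBot Ordinal.{u}) (b : Ordinal.{u}) : Set X :=
  {x | a < (hyperlog ξ (pointRank τ x) : WithBot Ordinal.{u}) ∧ hyperlog ξ (pointRank τ x) ≤ b}

/-- The generalized Icard topology `τ_{+lam}` of a scattered topology `τ`: the least topology
containing `τ` and all sets `(a, b]_ξ` with `-1 ≤ a < b ≤ ρ X` and `ξ < lam`. -/
@[reducible] def genIcard {X : Type v} (τ : TopologicalSpace X) (lam : Ordinal.{u}) : TopologicalSpace X :=
  TopologicalSpace.generateFrom
    ({U | @IsOpen X τ U} ∪
      {U | ∃ ξ < lam, ∃ (a : WithBot Ordinal.{u}) (b : Ordinal.{u}),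
        a < (b : WithBot Ordinal.{u}) ∧ b ≤ spaceRank τ ∧ U = icardInterval τ ξ a b})

/-- The left topology `I_0` on the ordinal `Θ`, generated by the sets `[0, b]`. -/
@[reducible] def leftTopology (Θ : Ordinal.{u}) : TopologicalSpace (Set.Iio Θ) :=
  TopologicalSpace.generateFrom {U | ∃ b : Set.Iio Θ, U = {x | x ≤ b}}

/-- The topology `I_lam = (I_0)_{+lam}` on the ordinal `Θ`. -/
@[reducible] def icardTopology (Θ lam : Ordinal.{u}) : TopologicalSpace (Set.Iio Θ) :=
  genIcard (leftTopology Θ) lam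

/-- `U` contains a club of `α`. -/
def ContainsClub {Θ : Ordinal.{u}} (U : Set (Set.Iio Θ)) (α : Set.Iio Θ) : Prop :=
  ∃ C : Set (Set.Iio α.1), IsClub C ∧ ∀ (γ : Set.Iio Θ) (h : γ.1 < α.1), ⟨γ.1, h⟩ ∈ C → γ ∈ U

/-- The club topology on the ordinal `Θ`: points of countable cofinality (including `0` and
successors) are isolated, and the neighbourhoods of a point `α` of uncountable cofinality are
the sets that contain `α` and a club of `α`. -/
@[reducible] def clubTopology (Θ : Ordinal.{u}) : TopologicalSpace (Set.Iio Θ) where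
  IsOpen U := ∀ α ∈ U, ℵ₀ < Ordinal.cof α.1 → ContainsClub U α
  isOpen_univ := fun α _ _ => ⟨Set.univ, IsClub.univ, fun _ _ _ => trivial⟩
  isOpen_inter := by
    intro U V hU hV α hα hc
    obtain ⟨C, hC, hCU⟩ := hU α hα.1 hc
    obtain ⟨D, hD, hDV⟩ := hV α hα.2 hc
    refine ⟨C ∩ D, IsClub.inter ?_ hC hD, fun γ h hγ => ⟨hCU γ h hγ.1, hDV γ h hγ.2⟩⟩
    rw [Ordinal.cof_Iio, ← Ordinal.lift_cof]
    intro h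
    exact hc.ne' (Cardinal.lift_eq_aleph0.1 h)
  isOpen_sUnion := by
    intro S hS α hα hc
    obtain ⟨U, hU, hαU⟩ := hα
    obtain ⟨C, hC, hCU⟩ := hS U hU α hαU hc
    exact ⟨C, hC, fun γ h hγ => ⟨U, hU, hCU γ h hγ⟩⟩

/-! ### Provability logic -/

/-- Modal formulas over the set `P` of propositional variables. -/
inductive ModalFormula (P : Type v) : Type v
  | var : P → ModalFormula P
  | neg : ModalFormula P → ModalFormula P
  | and : ModalFormula P → ModalFormula P → ModalFormula P
  | box : ModalFormula P → ModalFormula P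

namespace ModalFormula

variable {P : Type v}

/-- `φ → ψ` is `¬ (φ ∧ ¬ ψ)`. -/
def imp (φ ψ : ModalFormula P) : ModalFormula P := neg (and φ (neg ψ))

/-- `◇ φ` is `¬ □ ¬ φ`. -/
def dia (φ : ModalFormula P) : ModalFormula P := neg (box (neg φ))

/-- Propositional tautologies: true under every assignment of truth values to formulas that
respects the Boolean connectives. -/
def IsTautology (φ : ModalFormula P) : Prop :=
  ∀ t : ModalFormula P → Prop, (∀ ψ, t (neg ψ) ↔ ¬ t ψ) →
    (∀ ψ χ, t (and ψ χ) ↔ t ψ ∧ t χ) → t φ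

/-- Theorems of `GL(P)`. -/
inductive GLProvable : ModalFormula P → Prop
  | taut (φ : ModalFormula P) : IsTautology φ → GLProvable φ
  | axK (φ ψ : ModalFormula P) : GLProvable (imp (box (imp φ ψ)) (imp (box φ) (box ψ)))
  | axLob (φ : ModalFormula P) : GLProvable (imp (box (imp (box φ) φ)) (box φ))
  | mp (φ ψ : ModalFormula P) : GLProvable (imp φ ψ) → GLProvable φ → GLProvable ψ
  | nec (φ : ModalFormula P) : GLProvable φ → GLProvable (box φ)

/-- `φ` is derivable in `GL(P)` from the premises `Γ`: some implication
`γ₁ → (γ₂ → ⋯ → φ)` with `γ₁, γ₂, … ∈ Γ` is a theorem. -/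
def Derives (Γ : Set (ModalFormula P)) (φ : ModalFormula P) : Prop :=
  ∃ l : List (ModalFormula P), (∀ γ ∈ l, γ ∈ Γ) ∧ GLProvable (l.foldr imp φ)

/-- `Γ` is consistent with `GL(P)`: no contradiction is derivable from it. -/
def Consistent (Γ : Set (ModalFormula P)) : Prop :=
  ¬ ∃ φ, Derives Γ φ ∧ Derives Γ (neg φ)

/-- The set of points of the topological model `(X, τ, V)` at which a formula is true. -/
def truthSet {X : Type w} (τ : TopologicalSpace X) (V : P → Set X) : ModalFormula P → Set X
  | var p => V p
  | neg φ => (truthSet τ V φ)ᶜ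
  | and φ ψ => truthSet τ V φ ∩ truthSet τ V ψ
  | box φ => (@derivedSet X τ (truthSet τ V φ)ᶜ)ᶜ

theorem truthSet_dia {X : Type w} (τ : TopologicalSpace X) (V : P → Set X)
    (φ : ModalFormula P) : truthSet τ V (dia φ) = @derivedSet X τ (truthSet τ V φ) := by
  simp [dia, truthSet]

/-- `Γ` has a model at some point of the space `(X, τ)`. -/
def SatisfiableOn {X : Type w} (τ : TopologicalSpace X) (Γ : Set (ModalFormula P)) : Prop :=
  ∃ (V : P → Set X) (x : X), ∀ φ ∈ Γ, x ∈ truthSet τ V φ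

/-- `GL(P)` is strongly complete with respect to the class `K` of spaces: every consistent set of
formulas is satisfiable on a space in `K`. -/
def StronglyComplete (P : Type v) (K : Set (Σ X : Type w, TopologicalSpace X)) : Prop :=
  ∀ Γ : Set (ModalFormula P), Consistent Γ → ∃ S ∈ K, SatisfiableOn S.2 Γ

/-- The set `{◇ p_i} ∪ {□ (p_i → ◇ p_j) : i < j}`. -/
def chainSet {I : Type w} [LT I] (p : I → P) : Set (ModalFormula P) :=
  {φ | ∃ i, φ = dia (var (p i))} ∪
    {φ | ∃ i j, i < j ∧ φ = box (imp (var (p i)) (dia (var (p j))))}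

end ModalFormula

/-! Consistency is compactness over finite chains. A finite part of the set mentions finitely many
indices. It holds at a new bottom point below the chain of these indices, with each variable true at
its own index only, and finite orders validate `GL`.

For the negative part, suppose the set holds at `x`. For `i < j`, let `U i j` be the neighbourhood
of `x` consisting of the points `y` such that, if `y ≠ x` and `p i` holds at `y`, then `y` is a
limit of `p j`. If for some increasing sequence of indices the consecutive `U i j` had a common open
neighbourhood of `x`, then a point below `x` satisfying the first variable would yield a smaller one
satisfying the next, and so on: closed initial segments are open, so limits are approached from
below. This contradicts well-foundedness (`not_satisfiableOn_chainSet`).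

Neighbourhood filters of an Icard topology need not be closed under countable intersections, but
each is a union of at most `κ` filters that are (`completelyCovered_nhds_genIcard`). The filter is
the infimum of a countably complete one and, for each `ξ < λ`, the filter generated by a chain of
intervals. A chain of small cofinality contributes at most `κ` principal filters, one of large
cofinality is itself countably complete, and finite infima of the pieces suffice. Colouring a pair
`i < j` by a piece containing `U i j`, a weak Erdős–Rado theorem (`exists_strictMono_homogeneous`)
gives a sequence whose consecutive `U i j` all lie in one piece, hence so does their intersection.

The only property of the hyperlogarithms needed is `ℓ^ξ a ≤ a`. -/

/-! ### Monochromatic sequences for colourings of pairs -/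

section Partition

variable {I K : Type w} [LinearOrder I] [WellFoundedLT I]

/-- The tree order of a colouring of pairs: `k` lies below `i` if `k < i`, and `k` and `i` have the
same colours with all points below `k` in the tree. -/
noncomputable def TreeBelow (col : I → I → K) : I → I → Prop :=
  WellFoundedLT.fix fun k F i => k < i ∧ ∀ m (h : m < k), F m h k → col m k = col m i

/-- The bound `m < k` in the recursion can be dropped, since it is part of `m` lying below `k`. -/
theorem treeBelow_iff {col : I → I → K} {k i : I} :
    TreeBelow col k i ↔ k < i ∧ ∀ m, TreeBelow col m k → col m k = col m i := by
  have unfold_eq : ∀ k i, TreeBelow col k i ↔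
      k < i ∧ ∀ m, m < k → TreeBelow col m k → col m k = col m i := fun k i => by
    rw [TreeBelow, WellFoundedLT.fix_eq]
  rw [unfold_eq]
  exact ⟨fun h => ⟨h.1, fun m hm => h.2 m ((unfold_eq m k).1 hm).1 hm⟩,
    fun h => ⟨h.1, fun m _ hm => h.2 m hm⟩⟩

theorem TreeBelow.lt {col : I → I → K} {k i : I} (h : TreeBelow col k i) : k < i :=
  (treeBelow_iff.1 h).1

theorem TreeBelow.col_eq {col : I → I → K} {m k i : I} (h : TreeBelow col k i)
    (hm : TreeBelow col m k) : col m k = col m i :=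
  (treeBelow_iff.1 h).2 m hm

theorem TreeBelow.trans {col : I → I → K} {k j i : I} (hkj : TreeBelow col k j)
    (hji : TreeBelow col j i) : TreeBelow col k i := by
  induction k using WellFoundedLT.induction generalizing j i with
  | _ k ih =>
    refine treeBelow_iff.2 ⟨hkj.lt.trans hji.lt, fun m hm => ?_⟩
    rw [hkj.col_eq hm, hji.col_eq (ih m hm.lt hm hkj)]

/-- This is what makes the order a tree: the predecessors of a point form a chain. Hence along this
chain the colour of a pair depends only on its smaller element. -/
theorem TreeBelow.of_lt {col : I → I → K} {k j i : I} (hki : TreeBelow col k i)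
    (hji : TreeBelow col j i) (hkj : k < j) : TreeBelow col k j := by
  induction k using WellFoundedLT.induction with
  | _ k ih =>
    refine treeBelow_iff.2 ⟨hkj, fun m hm => ?_⟩
    rw [hki.col_eq hm, hji.col_eq (ih m hm.lt (hm.trans hki) (hm.lt.trans hkj))]

/-- A point is determined by the isomorphism type of the set of points below it in the tree,
together with the colours of the points in this set. -/
theorem eq_of_treeBelow_code_eq {A : Type*} {col : I → I → K} {i i' : I}
    {e : {k // TreeBelow col k i} → A} {e' : {k // TreeBelow col k i'} → A}
    (he : Function.Injective e) (he' : Function.Injective e')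
    (hord : {q : A × A | ∃ k m, k.1 ≤ m.1 ∧ q = (e k, e m)} =
      {q : A × A | ∃ k m, k.1 ≤ m.1 ∧ q = (e' k, e' m)})
    (hcol : {q : A × K | ∃ k, q = (e k, col k.1 i)} =
      {q : A × K | ∃ k, q = (e' k, col k.1 i')}) : i = i' := by
  have half : ∀ {i i' : I} {e : {k // TreeBelow col k i} → A}
      {e' : {k // TreeBelow col k i'} → A},
      Function.Injective e → Function.Injective e' →
      {q : A × A | ∃ k m, k.1 ≤ m.1 ∧ q = (e k, e m)} =
        {q : A × A | ∃ k m, k.1 ≤ m.1 ∧ q = (e' k, e' m)} →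
      {q : A × K | ∃ k, q = (e k, col k.1 i)} = {q : A × K | ∃ k, q = (e' k, col k.1 i')} →
      ∀ k, (∀ m < k, ∀ h : TreeBelow col m i, ∃ h' : TreeBelow col m i', e ⟨m, h⟩ = e' ⟨m, h'⟩) →
      (∀ m < k, ∀ h : TreeBelow col m i', ∃ h' : TreeBelow col m i, e' ⟨m, h⟩ = e ⟨m, h'⟩) →
      ∀ h : TreeBelow col k i, ∃ h' : TreeBelow col k i', e ⟨k, h⟩ = e' ⟨k, h'⟩ := by
    intro i i' e e' he he' hord hcol k ih ih' h
    have colours : ∀ m h h', e ⟨m, h⟩ = e' ⟨m, h'⟩ → col m i = col m i' := by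
      intro m h h' hm
      have : (e ⟨m, h⟩, col m i) ∈ {q : A × K | ∃ k, q = (e' k, col k.1 i')} :=
        hcol ▸ ⟨⟨m, h⟩, rfl⟩
      obtain ⟨r, hr⟩ := this
      rw [Prod.mk.injEq, hm] at hr
      rw [hr.2, ← he' hr.1]
    -- The diagonal of the coded order records the range of the coding, so the code of `k` is also
    -- the code of some `k'` below `i'`. Induction and injectivity then exclude `k' < k` and `k <
    -- k'`.
    have mem : (e ⟨k, h⟩, e ⟨k, h⟩) ∈ {q : A × A | ∃ k m, k.1 ≤ m.1 ∧ q = (e' k, e' m)} :=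
      hord ▸ ⟨⟨k, h⟩, ⟨k, h⟩, le_rfl, rfl⟩
    obtain ⟨⟨k', hk'⟩, _, _, hkk⟩ := mem
    have hk : e ⟨k, h⟩ = e' ⟨k', hk'⟩ := (Prod.mk.inj hkk).1
    rcases lt_trichotomy k' k with hlt | rfl | hlt
    · obtain ⟨h1, h2⟩ := ih' k' hlt hk'
      have := congrArg Subtype.val (he (hk.trans h2))
      exact absurd this hlt.ne'
    · exact ⟨hk', hk⟩
    · have hki : TreeBelow col k i' := by
        refine treeBelow_iff.2 ⟨hlt.trans hk'.lt, fun m hm => ?_⟩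
        obtain ⟨h1, h2⟩ := ih m hm.lt (hm.trans h)
        rw [h.col_eq hm, colours m _ _ h2]
      have mem : (e' ⟨k, hki⟩, e' ⟨k', hk'⟩) ∈
          {q : A × A | ∃ k m, k.1 ≤ m.1 ∧ q = (e k, e m)} :=
        hord ▸ ⟨⟨k, hki⟩, ⟨k', hk'⟩, hlt.le, rfl⟩
      obtain ⟨⟨r, hr⟩, m, hle, hq⟩ := mem
      rw [Prod.mk.injEq, ← hk] at hq
      obtain rfl := he hq.2
      rcases (show r ≤ k from hle).lt_or_eq with hrk | rfl
      · obtain ⟨h1, h2⟩ := ih r hrk hr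
        have := congrArg Subtype.val (he' (hq.1.trans h2))
        exact absurd this hrk.ne'
      · have := congrArg Subtype.val (he' (hq.1.trans hk))
        exact absurd this hlt.ne
  have both : ∀ k,
      (∀ h : TreeBelow col k i, ∃ h' : TreeBelow col k i', e ⟨k, h⟩ = e' ⟨k, h'⟩) ∧
      (∀ h : TreeBelow col k i', ∃ h' : TreeBelow col k i, e' ⟨k, h⟩ = e ⟨k, h'⟩) := by
    intro k
    induction k using WellFoundedLT.induction with
    | _ k ih =>
      exact ⟨half he he' hord hcol k (fun m hm => (ih m hm).1) (fun m hm => (ih m hm).2),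
        half he' he hord.symm hcol.symm k (fun m hm => (ih m hm).2) (fun m hm => (ih m hm).1)⟩
  have colours : ∀ m, TreeBelow col m i → col m i = col m i' := by
    intro m h
    obtain ⟨h', hm⟩ := (both m).1 h
    have : (e ⟨m, h⟩, col m i) ∈ {q : A × K | ∃ k, q = (e' k, col k.1 i')} :=
      hcol ▸ ⟨⟨m, h⟩, rfl⟩
    obtain ⟨r, hr⟩ := this
    rw [Prod.mk.injEq, hm] at hr
    rw [hr.2, ← he' hr.1]
  -- If `i < i'`, the equal colours put `i` below `i'` in the tree, hence below itself, as both
  -- points have the same predecessors.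
  rcases lt_trichotomy i i' with hlt | rfl | hlt
  · obtain ⟨h, -⟩ := (both i).2 (treeBelow_iff.2 ⟨hlt, colours⟩)
    exact absurd h.lt (lt_irrefl _)
  · rfl
  · obtain ⟨h, -⟩ := (both i').1 (treeBelow_iff.2 ⟨hlt, fun m hm =>
      (colours m ((both m).2 hm).1).symm⟩)
    exact absurd h.lt (lt_irrefl _)

/-- If there are more than `2 ^ #K` points, then some point has more than `#K` points below it
in the tree. -/
theorem exists_mk_lt_mk_treeBelow [Infinite K] (h : (2 : Cardinal.{w}) ^ #K < #I)
    (col : I → I → K) : ∃ i, #K < #{k // TreeBelow col k i} := by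
  by_contra! hle
  have emb : ∀ i, Nonempty ({k // TreeBelow col k i} ↪ K) := fun i => (hle i)
  let e i := (emb i).some
  let code : I → Set (K × K) × Set (K × K) := fun i =>
    ({q | ∃ k m, k.1 ≤ m.1 ∧ q = (e i k, e i m)}, {q | ∃ k, q = (e i k, col k.1 i)})
  have inj : Function.Injective code := fun i i' hc =>
    eq_of_treeBelow_code_eq (e i).injective (e i').injective (congrArg Prod.fst hc)
      (congrArg Prod.snd hc)
  refine h.not_ge ((mk_le_of_injective inj).trans ?_)
  have hK : ℵ₀ ≤ #K := infinite_iff.1 inferInstance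
  have h2 : ℵ₀ ≤ (2 : Cardinal.{w}) ^ #K := hK.trans (cantor _).le
  simp [mk_set, mul_eq_self hK, mul_eq_self h2]

/-- An infinite subset of a well-order contains an increasing sequence. -/
theorem exists_strictMono_of_infinite {s : Set I} (hs : s.Infinite) :
    ∃ f : ℕ → I, StrictMono f ∧ ∀ n, f n ∈ s := by
  have := hs.to_subtype
  obtain ⟨g, hg⟩ := exists_increasing_or_nonincreasing_subseq (· < ·)
    (fun n => ((Infinite.natEmbedding s n : s) : I))
  rcases hg with hg | hg
  · exact ⟨_, fun m n hmn => hg m n hmn, fun n => (Infinite.natEmbedding s (g n)).2⟩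
  · exfalso
    refine (RelEmbedding.wellFounded_iff_isEmpty.1 (wellFounded_lt (α := I))).false
      (RelEmbedding.natGT (fun n => ((Infinite.natEmbedding s (g n) : s) : I)) fun n => ?_)
    -- Injectivity of the enumeration makes the nonincreasing subsequence strictly decreasing.
    refine lt_of_le_of_ne (not_lt.1 (hg n (n + 1) n.lt_succ_self)) fun he => ?_
    have := g.injective ((Infinite.natEmbedding s).injective (Subtype.ext he))
    omega

/-- A weak form of the Erdős–Rado theorem: every colouring of the pairs of a well-order with more
than `2 ^ #K` points by the colours in `K` has an infinite homogeneous increasing sequence. -/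
theorem exists_strictMono_homogeneous [Infinite K] (h : (2 : Cardinal.{w}) ^ #K < #I)
    (col : I → I → K) :
    ∃ (f : ℕ → I) (c : K), StrictMono f ∧ ∀ m n, m < n → col (f m) (f n) = c := by
  obtain ⟨i, hi⟩ := exists_mk_lt_mk_treeBelow h col
  -- By pigeonhole, infinitely many predecessors of `i` have the same colour with `i`; among
  -- predecessors, the colour with `i` is also the colour with every later one.
  have : Infinite {k // TreeBelow col k i} :=
    infinite_iff.2 ((infinite_iff.1 (inferInstance : Infinite K)).trans hi.le)
  obtain ⟨c, hc⟩ := exists_infinite_fiber (fun k : {k // TreeBelow col k i} => col k.1 i) hi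
  have hinf : (Subtype.val '' ((fun k : {k // TreeBelow col k i} => col k.1 i) ⁻¹' {c})).Infinite :=
    (Set.infinite_coe_iff.1 hc).image Subtype.val_injective.injOn
  obtain ⟨f, hf, hfs⟩ := exists_strictMono_of_infinite hinf
  refine ⟨f, c, hf, fun m n hmn => ?_⟩
  obtain ⟨⟨k, hk⟩, hkc, hkm⟩ := hfs m
  obtain ⟨⟨j, hj⟩, hjc, hjn⟩ := hfs n
  simp only at hkm hjn
  subst hkm hjn
  rw [hj.col_eq (hk.of_lt hj (hf hmn))]
  exact hkc

end Partition

/-! ### Filters covered by few countably complete filters -/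

section Covered

open Filter

/-- A filter is covered by `κ` countably complete filters if it is the union of at most `κ`
filters that are closed under countable intersections. -/
def CompletelyCovered {X : Type w} (κ : Cardinal.{w}) (l : Filter X) : Prop :=
  ∃ 𝒢 : Set (Filter X), #𝒢 ≤ κ ∧ (∀ G ∈ 𝒢, CountableInterFilter G ∧ l ≤ G) ∧
    ∀ U ∈ l, ∃ G ∈ 𝒢, U ∈ G

variable {X : Type w} {κ : Cardinal.{w}}

theorem CompletelyCovered.of_countableInterFilter (hκ : ℵ₀ ≤ κ) (l : Filter X)
    [h : CountableInterFilter l] : CompletelyCovered κ l :=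
  ⟨{l}, by simpa using one_le_aleph0.trans hκ, by simpa using h, by simp⟩

/-- A member of an infimum is a finite intersection of members of the given filters, so finite
infima of the covering filters suffice. There are at most `κ` of these, and finite infima preserve
countable completeness. -/
theorem CompletelyCovered.iInf {ι : Type w} {l : ι → Filter X} (hκ : ℵ₀ ≤ κ) (hι : #ι ≤ κ)
    (h : ∀ i, CompletelyCovered κ (l i)) : CompletelyCovered κ (⨅ i, l i) := by
  classical
  choose 𝒢 hcard hG hcov using h
  refine ⟨Set.range fun t : Finset (Σ i, 𝒢 i) => ⨅ q ∈ t, (q.2 : Filter X), ?_, ?_, fun U hU => ?_⟩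
  · refine mk_range_le.trans ((mk_le_of_surjective
      (List.toFinset_surjective (α := Σ i, 𝒢 i))).trans ((mk_list_le_max _).trans (max_le hκ ?_)))
    rw [mk_sigma]
    calc (sum fun i => #(𝒢 i)) ≤ sum fun _ : ι => κ := sum_le_sum _ _ hcard
      _ = #ι * κ := by simp
      _ ≤ κ * κ := mul_le_mul_left hι κ
      _ = κ := mul_eq_self hκ
  · rintro _ ⟨t, rfl⟩
    refine ⟨?_, le_iInf₂ fun q _ => (iInf_le l q.1).trans (hG q.1 _ q.2.2).2⟩
    induction t using Finset.induction_on with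
    | empty => simpa using countableInterFilter_top
    | insert q t _ ih =>
      have := (hG q.1 _ q.2.2).1
      have ih : CountableInterFilter (⨅ q ∈ t, (q.2 : Filter X)) := ih
      simp only [Finset.iInf_insert]
      exact countableInterFilter_inf _ _
  · obtain ⟨J, hJ, V, hV, rfl⟩ := mem_iInf.1 hU
    have := hJ.to_subtype
    choose G hGm hVG using fun i : J => hcov i (V i) (hV i)
    have := Fintype.ofFinite J
    refine ⟨_, ⟨Finset.univ.image fun i : J => ⟨i.1, G i, hGm i⟩, rfl⟩, iInter_mem.2 fun i => ?_⟩
    exact (iInf₂_le (f := fun (q : Σ i, 𝒢 i) (_ : q ∈ Finset.univ.image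
      fun i : J => (⟨i.1, G i, hGm i⟩ : Σ i, 𝒢 i)) => (q.2 : Filter X)) ⟨i.1, G i, hGm i⟩
      (Finset.mem_image_of_mem _ (Finset.mem_univ i))) (hVG i)

theorem CompletelyCovered.inf {l₁ l₂ : Filter X} (hκ : ℵ₀ ≤ κ) (h₁ : CompletelyCovered κ l₁)
    (h₂ : CompletelyCovered κ l₂) : CompletelyCovered κ (l₁ ⊓ l₂) := by
  have : l₁ ⊓ l₂ = ⨅ b : ULift.{w} Bool, (if b.down then l₁ else l₂) := by
    rw [← Equiv.ulift.symm.surjective.iInf_comp, iInf_bool_eq]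
    simp
  rw [this]
  refine .iInf hκ ((mk_le_aleph0).trans hκ) fun b => ?_
  split_ifs
  exacts [h₁, h₂]

/-- The filter generated by a decreasing family of sets indexed by a linear order is covered by
few principal filters if the cofinality of the order is small, and countably complete
otherwise. -/
theorem CompletelyCovered.iInf_principal {A : Type w} [LinearOrder A] [Nonempty A]
    (hκ : ℵ₀ ≤ κ) {W : A → Set X} (hW : Antitone W) :
    CompletelyCovered κ (⨅ a, 𝓟 (W a)) := by
  have mem : ∀ U, U ∈ ⨅ a, 𝓟 (W a) ↔ ∃ a, W a ⊆ U := fun U => by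
    rw [mem_iInf_of_directed]
    · simp
    · exact directed_of_isDirected_le fun a b h => principal_mono.2 (hW h)
  by_cases h : ∃ S : Set A, #S ≤ κ ∧ IsCofinal S
  · obtain ⟨S, hS, hSc⟩ := h
    refine ⟨(fun a => 𝓟 (W a)) '' S, mk_image_le.trans hS, ?_, fun U hU => ?_⟩
    · rintro _ ⟨a, -, rfl⟩
      exact ⟨inferInstance, iInf_le _ a⟩
    · obtain ⟨a, ha⟩ := (mem U).1 hU
      obtain ⟨b, hb, hab⟩ := hSc a
      exact ⟨_, ⟨b, hb, rfl⟩, (hW hab).trans ha⟩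
  · have : CountableInterFilter (⨅ a, 𝓟 (W a)) := by
      refine ⟨fun S hS hSl => ?_⟩
      have := hS.to_subtype
      choose a ha using fun U : S => (mem U).1 (hSl U U.2)
      -- As no set of size at most `κ` is cofinal, countably many indices have a common upper bound.
      have hr : ¬ IsCofinal (Set.range a) := fun hc =>
        h ⟨_, (le_aleph0_iff_set_countable.2 (Set.countable_range a)).trans hκ, hc⟩
      obtain ⟨b, hb⟩ : ∃ b, ∀ U, a U < b := by
        simpa [IsCofinal] using hr
      exact (mem _).2 ⟨b, Set.subset_sInter fun U hU => (hW (hb ⟨U, hU⟩).le).trans (ha ⟨U, hU⟩)⟩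
    exact .of_countableInterFilter hκ _

/-- Among more than `2 ^ κ` indices, any family of members of a covered filter indexed by pairs
has an increasing sequence along which the intersection of the consecutive members is still
in the filter. -/
theorem CompletelyCovered.exists_iInter_mem {I : Type w} [LinearOrder I] [WellFoundedLT I]
    {l : Filter X} (hl : CompletelyCovered κ l) (hκ : ℵ₀ ≤ κ) (hI : 2 ^ κ < #I)
    {U : I → I → Set X} (hU : ∀ i j, i < j → U i j ∈ l) :
    ∃ f : ℕ → I, StrictMono f ∧ ⋂ n, U (f n) (f (n + 1)) ∈ l := by
  obtain ⟨𝒢, hcard, hG, hcov⟩ := hl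
  induction κ using Cardinal.inductionOn with
  | _ K =>
    have : Infinite K := infinite_iff.2 hκ
    obtain ⟨e⟩ := hcard
    obtain ⟨G₀, hG₀, -⟩ := hcov _ univ_mem
    -- The colour of a pair is a covering filter containing its set; `G₀` is a dummy colour for
    -- pairs that are not increasing.
    have : ∀ i j, ∃ G : 𝒢, i < j → U i j ∈ G.1 := fun i j => by
      by_cases hij : i < j
      · obtain ⟨G, hG, h⟩ := hcov _ (hU i j hij)
        exact ⟨⟨G, hG⟩, fun _ => h⟩
      · exact ⟨⟨G₀, hG₀⟩, fun h => absurd h hij⟩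
    choose col hcol using this
    obtain ⟨f, c, hf, hc⟩ := exists_strictMono_homogeneous hI fun i j => e (col i j)
    refine ⟨f, hf, ?_⟩
    have := (hG _ (col (f 0) (f 1)).2).1
    refine (hG _ (col (f 0) (f 1)).2).2 (countable_iInter_mem.2 fun n => ?_)
    have he : col (f n) (f (n + 1)) = col (f 0) (f 1) :=
      e.injective ((hc n (n + 1) n.lt_succ_self).trans (hc 0 1 one_pos).symm)
    exact he ▸ hcol _ _ (hf n.lt_succ_self)

end Covered

/-! ### Neighbourhoods in generalized Icard topologies -/

section Icard

open Filter Topology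

variable {X : Type (u + 1)}

theorem hyperlog_le (ξ a : Ordinal.{u}) : hyperlog ξ a ≤ a :=
  (isHyperlog_hyperlog.initial ξ).le a

theorem icardInterval_subset {τ : TopologicalSpace X} {ξ : Ordinal.{u}}
    {a : WithBot Ordinal.{u}} {b c : Ordinal.{u}} (h : c ≤ b) :
    icardInterval τ ξ a c ⊆ icardInterval τ ξ a b :=
  fun _ hy => ⟨hy.1, hy.2.trans h⟩

theorem genIcard_le (τ : TopologicalSpace X) (lam : Ordinal.{u}) : genIcard τ lam ≤ τ :=
  fun _ hU => .basic _ (Or.inl hU)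

/-- Lowering the right endpoint of an interval to the value at `x` only shrinks it, and this
endpoint is admissible because `ℓ^ξ (ρ x) ≤ ρ x`. So for each `ξ` only the left endpoint varies, and
the intervals form a chain. -/
theorem nhds_genIcard [Small.{u} X] (τ : TopologicalSpace X) (lam : Ordinal.{u}) (x : X) :
    @nhds X (genIcard τ lam) x = @nhds X τ x ⊓
      ⨅ ξ : Set.Iio lam, ⨅ a : {a : WithBot Ordinal.{u} // a < hyperlog ξ (pointRank τ x)},
        𝓟 (icardInterval τ ξ a (hyperlog ξ (pointRank τ x))) := by
  refine le_antisymm (le_inf (nhds_mono (genIcard_le τ lam)) (le_iInf₂ fun ξ a => ?_)) ?_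
  · refine le_principal_iff.2 (@IsOpen.mem_nhds _ (genIcard τ lam) x _ ?_ ⟨a.2, le_rfl⟩)
    refine .basic _ (Or.inr ⟨ξ, ξ.2, a, _, a.2, ?_, rfl⟩)
    exact (hyperlog_le _ _).trans ((Order.le_succ _).trans
      (Ordinal.le_iSup (fun x => pointRank τ x + 1) x))
  · rw [TopologicalSpace.nhds_generateFrom]
    refine le_iInf₂ ?_
    rintro s ⟨hx, hs | ⟨ξ, hξ, a, b, -, -, rfl⟩⟩
    · exact inf_le_left.trans (le_principal_iff.2 (@IsOpen.mem_nhds _ τ x s hs hx))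
    · exact inf_le_right.trans ((iInf₂_le (⟨ξ, hξ⟩ : Set.Iio lam) ⟨a, hx.1⟩).trans
        (principal_mono.2 (icardInterval_subset hx.2)))

theorem completelyCovered_nhds_genIcard [Small.{u} X] {τ : TopologicalSpace X}
    (hτ : ∀ S : Set (Set X), S.Countable → (∀ U ∈ S, @IsOpen X τ U) → @IsOpen X τ (⋂₀ S))
    {lam : Ordinal.{u}} {κ : Cardinal.{u + 1}} (hκ : ℵ₀ ≤ κ)
    (hlam : Cardinal.lift.{u + 1} lam.card ≤ κ) (x : X) :
    CompletelyCovered κ (@nhds X (genIcard τ lam) x) := by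
  rw [nhds_genIcard]
  have : CountableInterFilter (@nhds X τ x) := by
    refine ⟨fun S hS h => ?_⟩
    choose! V hVU hV hx using fun U hU => mem_nhds_iff.1 (h U hU)
    refine mem_nhds_iff.2 ⟨⋂₀ (V '' S), Set.subset_sInter fun U hU => ?_,
      hτ _ (hS.image V) (Set.forall_mem_image.2 hV), Set.mem_sInter.2 (Set.forall_mem_image.2 hx)⟩
    exact (Set.sInter_subset_of_mem (Set.mem_image_of_mem V hU)).trans (hVU U hU)
  refine .inf hκ (.of_countableInterFilter hκ _) (.iInf hκ ?_ fun ξ => ?_)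
  · rwa [Cardinal.mk_Iio_ordinal]
  · have : Nonempty {a : WithBot Ordinal.{u} // a < hyperlog ξ (pointRank τ x)} :=
      ⟨⟨⊥, WithBot.bot_lt_coe _⟩⟩
    exact .iInf_principal hκ fun a b hab y hy => ⟨lt_of_le_of_lt hab hy.1, hy.2⟩

/-- On a well-ordered space with closed initial segments open, whose neighbourhood filters are
covered by `κ` countably complete filters, the set `chainSet p` on more than `2 ^ κ` variables is
not satisfiable. -/
theorem not_satisfiableOn_chainSet [LinearOrder X] [WellFoundedLT X] {τ : TopologicalSpace X}
    (hIic : ∀ y : X, @IsOpen X τ (Set.Iic y)) {κ : Cardinal.{u + 1}} (hκ : ℵ₀ ≤ κ)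
    (hτ : ∀ x, CompletelyCovered κ (@nhds X τ x)) {I : Type (u + 1)} [LinearOrder I]
    [WellFoundedLT I] (hI : 2 ^ κ < #I) {P : Type v} (p : I → P) :
    ¬ ModalFormula.SatisfiableOn τ (ModalFormula.chainSet p) := by
  rintro ⟨V, x, hx⟩
  have hdia : ∀ i, x ∈ @derivedSet X τ (V (p i)) := fun i => by
    simpa [ModalFormula.truthSet_dia, ModalFormula.truthSet] using hx _ (Or.inl ⟨i, rfl⟩)
  -- The clause `y ≠ x` is needed because a box speaks about punctured neighbourhoods only.
  have hbox : ∀ i j, i < j → {y | y ≠ x → y ∈ V (p i) → y ∈ derivedSet (V (p j))} ∈ 𝓝 x := by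
    intro i j hij
    have h := hx _ (Or.inr ⟨i, j, hij, rfl⟩)
    have h : ¬ AccPt x (𝓟 (V (p i) ∩ (derivedSet (V (p j)))ᶜ)) := by
      simpa [ModalFormula.truthSet, ModalFormula.imp, ModalFormula.truthSet_dia,
        mem_derivedSet] using h
    rw [accPt_iff_nhds] at h
    push Not at h
    obtain ⟨U, hU, h⟩ := h
    refine mem_of_superset hU fun y hy hne hyp => ?_
    by_contra hd
    exact hne (h y ⟨hy, hyp, hd⟩)
  obtain ⟨f, -, hf⟩ := (hτ x).exists_iInter_mem hκ hI hbox
  obtain ⟨U, hUsub, hU, hxU⟩ := mem_nhds_iff.1 hf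
  -- Infinite descent: intersecting `U` with the open set `Set.Iic y` forces the next witness
  -- strictly below `y`. Quantifying over all `n` lets the index rise as the point falls.
  have step : ∀ y < x, y ∈ U → ∀ n, y ∉ V (p (f n)) := by
    intro y
    induction y using WellFoundedLT.induction with
    | _ y ih =>
      intro hyx hyU n hyn
      have hd : y ∈ derivedSet (V (p (f (n + 1)))) :=
        Set.mem_iInter.1 (hUsub hyU) n hyx.ne hyn
      obtain ⟨z, ⟨⟨hzU, hzy⟩, hzV⟩, hne⟩ := accPt_iff_nhds.1 hd _
        ((hU.inter (hIic y)).mem_nhds ⟨hyU, Set.mem_Iic.2 le_rfl⟩)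
      have hzy : z < y := lt_of_le_of_ne hzy hne
      exact ih z hzy (hzy.trans hyx) hzU (n + 1) hzV
  obtain ⟨z, ⟨⟨hzU, hzx⟩, hzV⟩, hne⟩ := accPt_iff_nhds.1 (hdia (f 0)) _
    ((hU.inter (hIic x)).mem_nhds ⟨hxU, Set.mem_Iic.2 le_rfl⟩)
  exact step z (lt_of_le_of_ne hzx hne) hzU 0 hzV

/-! ### The left topology and the club topology -/

variable {Θ : Ordinal.{u}}

theorem isOpen_leftTopology_Iic (y : Set.Iio Θ) : @IsOpen _ (leftTopology Θ) (Set.Iic y) :=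
  .basic _ ⟨y, rfl⟩

/-- This makes arbitrary intersections of open sets open. -/
theorem isOpen_leftTopology_iff {U : Set (Set.Iio Θ)} :
    @IsOpen _ (leftTopology Θ) U ↔ IsLowerSet U := by
  constructor
  · intro h
    induction h with
    | basic s hs =>
      obtain ⟨b, rfl⟩ := hs
      exact isLowerSet_Iic b
    | univ => exact isLowerSet_univ
    | inter s t _ _ hs ht => exact hs.inter ht
    | sUnion S _ hS => exact isLowerSet_sUnion hS
  · intro h
    have : U = ⋃ y ∈ U, Set.Iic y := by
      ext z
      simp only [Set.mem_iUnion, Set.mem_Iic, exists_prop]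
      exact ⟨fun hz => ⟨z, hz, le_rfl⟩, fun ⟨y, hy, hzy⟩ => h hzy hy⟩
    rw [this]
    exact @isOpen_biUnion _ _ (leftTopology Θ) _ _ fun y _ => isOpen_leftTopology_Iic y

theorem isOpen_leftTopology_sInter (S : Set (Set (Set.Iio Θ)))
    (hS : ∀ U ∈ S, @IsOpen _ (leftTopology Θ) U) : @IsOpen _ (leftTopology Θ) (⋂₀ S) :=
  isOpen_leftTopology_iff.2 (isLowerSet_sInter fun U hU => isOpen_leftTopology_iff.1 (hS U hU))

theorem isOpen_clubTopology_Iic (y : Set.Iio Θ) : @IsOpen _ (clubTopology Θ) (Set.Iic y) :=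
  fun α hα _ => ⟨Set.univ, IsClub.univ, fun γ h _ => (show γ < α from h).le.trans hα⟩

/-- At a point of uncountable cofinality, countably many clubs intersect in a club. -/
theorem isOpen_clubTopology_sInter (S : Set (Set (Set.Iio Θ))) (hS : S.Countable)
    (h : ∀ U ∈ S, @IsOpen _ (clubTopology Θ) U) : @IsOpen _ (clubTopology Θ) (⋂₀ S) := by
  intro α hα hc
  have := hS.to_subtype
  choose C hC hCU using fun U : S => h U U.2 α (hα U U.2) hc
  refine ⟨⋂ U, C U, IsClub.iInter_of_countable ?_ hC, fun γ hγ hmem U hU =>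
    hCU ⟨U, hU⟩ γ hγ (Set.mem_iInter.1 hmem ⟨U, hU⟩)⟩
  rw [Ordinal.cof_Iio, ← Ordinal.lift_cof]
  intro h
  exact hc.ne' (Cardinal.lift_eq_aleph0.1 h)

end Icard

/-! ### Kripke semantics and consistency -/

namespace ModalFormula

variable {P : Type v}

/-- Truth at a point of a Kripke model on a preorder whose strict order is the accessibility
relation. -/
def KripkeSat {W : Type w} [Preorder W] (V : P → Set W) : ModalFormula P → W → Prop
  | var p, x => x ∈ V p
  | neg φ, x => ¬ KripkeSat V φ x
  | and φ ψ, x => KripkeSat V φ x ∧ KripkeSat V ψ x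
  | box φ, x => ∀ y, x < y → KripkeSat V φ y

section

variable {W : Type w} [Preorder W] {V : P → Set W} {x : W}

theorem kripkeSat_imp {φ ψ : ModalFormula P} :
    KripkeSat V (imp φ ψ) x ↔ (KripkeSat V φ x → KripkeSat V ψ x) := by
  simp [imp, KripkeSat]

theorem kripkeSat_dia {φ : ModalFormula P} :
    KripkeSat V (dia φ) x ↔ ∃ y, x < y ∧ KripkeSat V φ y := by
  simp [dia, KripkeSat]

theorem GLProvable.kripkeSat [WellFoundedGT W] {φ : ModalFormula P} (h : GLProvable φ) (x : W) :
    KripkeSat V φ x := by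
  induction h generalizing x with
  | taut φ h => exact h (fun ψ => KripkeSat V ψ x) (fun _ => Iff.rfl) fun _ _ => Iff.rfl
  | axK φ ψ =>
    simp only [kripkeSat_imp, KripkeSat]
    exact fun h1 h2 y hy => h1 y hy (h2 y hy)
  | axLob φ =>
    simp only [kripkeSat_imp, KripkeSat]
    intro h y
    -- Löb's axiom is induction along the converse of the accessibility relation.
    induction y using WellFoundedGT.induction with
    | _ y ih => exact fun hy => h y hy fun z hz => ih z hz (hy.trans hz)
  | mp φ ψ _ _ ih1 ih2 => exact kripkeSat_imp.1 (ih1 x) (ih2 x)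
  | nec φ _ ih => exact fun y _ => ih y

theorem kripkeSat_of_foldr_imp {l : List (ModalFormula P)} {φ : ModalFormula P}
    (h : KripkeSat V (l.foldr imp φ) x) (hl : ∀ γ ∈ l, KripkeSat V γ x) : KripkeSat V φ x := by
  induction l with
  | nil => exact h
  | cons γ l ih =>
    simp only [List.mem_cons, forall_eq_or_imp] at hl
    exact ih (kripkeSat_imp.1 h hl.1) hl.2

end

/-- A set of formulas is consistent if each of its finite parts holds at a point of a conversely
well-founded Kripke model. -/
theorem consistent_of_forall_list {Γ : Set (ModalFormula P)}
    (h : ∀ l : List (ModalFormula P), (∀ γ ∈ l, γ ∈ Γ) →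
      ∃ (W : Type w) (_ : Preorder W) (_ : WellFoundedGT W) (V : P → Set W) (x : W),
        ∀ γ ∈ l, KripkeSat V γ x) : Consistent Γ := by
  rintro ⟨φ, ⟨l, hl, hφ⟩, ⟨m, hm, hψ⟩⟩
  obtain ⟨W, _, _, V, x, hx⟩ := h (l ++ m) fun γ hγ =>
    (List.mem_append.1 hγ).elim (hl γ) (hm γ)
  exact kripkeSat_of_foldr_imp (hψ.kripkeSat x) (fun γ hγ => hx γ (List.mem_append_right _ hγ))
    (kripkeSat_of_foldr_imp (hφ.kripkeSat x) fun γ hγ => hx γ (List.mem_append_left _ hγ))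

/-- On a finite linear order with a new bottom element, in which the variable `p i` holds at `i`
only, the bottom satisfies all formulas of `chainSet p` about elements of the order. -/
theorem exists_finset_kripkeSat {I : Type w} [LinearOrder I] {p : I → P}
    (hp : Function.Injective p) {γ : ModalFormula P} (hγ : γ ∈ chainSet p) :
    ∃ J : Finset I, ∀ J', J ⊆ J' →
      KripkeSat (W := WithBot {i // i ∈ J'}) (fun q => {x | ∃ i : {i // i ∈ J'}, x = ↑i ∧ p i.1 = q}) γ ⊥ := by
  classical
  rcases hγ with ⟨i, rfl⟩ | ⟨i, j, hij, rfl⟩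
  · refine ⟨{i}, fun J' hJ => kripkeSat_dia.2 ⟨((⟨i, hJ (by simp)⟩ : {i // i ∈ J'}) : WithBot _),
      WithBot.bot_lt_coe _, ?_⟩⟩
    exact ⟨_, rfl, rfl⟩
  · refine ⟨{j}, fun J' hJ y _ => kripkeSat_imp.2 ?_⟩
    rintro ⟨k, rfl, hk⟩
    refine kripkeSat_dia.2 ⟨((⟨j, hJ (by simp)⟩ : {i // i ∈ J'}) : WithBot _), ?_, _, rfl, rfl⟩
    -- Injectivity of `p` ensures that `p i` holds at the index `i` only.
    rw [WithBot.coe_lt_coe, ← Subtype.coe_lt_coe, hp hk]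
    exact hij

theorem consistent_chainSet {I : Type w} [LinearOrder I] {p : I → P}
    (hp : Function.Injective p) : Consistent (chainSet p) := by
  classical
  refine consistent_of_forall_list.{v, w} fun l hl => ?_
  -- Truth persists to all larger finite index sets, so the sets for the single formulas can be
  -- united.
  have : ∃ J : Finset I, ∀ J', J ⊆ J' → ∀ γ ∈ l,
      KripkeSat (W := WithBot {i // i ∈ J'}) (fun q => {x | ∃ i : {i // i ∈ J'}, x = ↑i ∧ p i.1 = q}) γ ⊥ := by
    induction l with
    | nil => exact ⟨∅, by simp⟩
    | cons γ l ih =>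
      simp only [List.mem_cons, forall_eq_or_imp] at hl
      obtain ⟨J, hJ⟩ := exists_finset_kripkeSat hp hl.1
      obtain ⟨J₁, hJ₁⟩ := ih hl.2
      refine ⟨J ∪ J₁, fun J' h => ?_⟩
      simp only [List.mem_cons, forall_eq_or_imp]
      exact ⟨hJ J' (Finset.union_subset_left h), hJ₁ J' (Finset.union_subset_right h)⟩
  obtain ⟨J, hJ⟩ := this
  have : Finite (WithBot {i // i ∈ J}) := inferInstanceAs (Finite (Option _))
  exact ⟨_, inferInstance, inferInstance, _, ⊥, hJ J subset_rfl⟩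

end ModalFormula

theorem theorem1 (lam : Ordinal.{u}) (P : Type v)
    (p : Set.Iio (Order.succ ((2 : Cardinal.{u}) ^ (lam.card + ℵ₀))).ord ≃ P) :
    ModalFormula.Consistent (ModalFormula.chainSet p) ∧
    (∀ Θ : Ordinal.{u},
      ¬ ModalFormula.SatisfiableOn (icardTopology Θ lam) (ModalFormula.chainSet p)) ∧
    (∀ Θ : Ordinal.{u},
      ¬ ModalFormula.SatisfiableOn (genIcard (clubTopology Θ) lam) (ModalFormula.chainSet p)) ∧
    (∀ K : Set (Σ X : Type (u + 1), TopologicalSpace X),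
      (∀ S ∈ K, ∃ Θ : Ordinal.{u},
        S = ⟨Set.Iio Θ, icardTopology Θ lam⟩ ∨ S = ⟨Set.Iio Θ, genIcard (clubTopology Θ) lam⟩) →
      ¬ ModalFormula.StronglyComplete P K) := by
  -- The points of the spaces and the indices form types one universe up, so `κ` is lifted.
  have hκ : ℵ₀ ≤ Cardinal.lift.{u + 1} (lam.card + ℵ₀) := aleph0_le_lift.2 le_add_self
  have hlam : Cardinal.lift.{u + 1} lam.card ≤ Cardinal.lift.{u + 1} (lam.card + ℵ₀) :=
    Cardinal.lift_le.2 le_self_add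
  have hI : 2 ^ Cardinal.lift.{u + 1} (lam.card + ℵ₀) <
      #(Set.Iio (Order.succ ((2 : Cardinal.{u}) ^ (lam.card + ℵ₀))).ord) := by
    rw [Cardinal.mk_Iio_ordinal, card_ord, ← Cardinal.lift_two.{u + 1, u}, ← Cardinal.lift_power,
      Cardinal.lift_lt]
    exact Order.lt_succ _
  have hcons := ModalFormula.consistent_chainSet p.injective
  have hleft : ∀ Θ : Ordinal.{u},
      ¬ ModalFormula.SatisfiableOn (icardTopology Θ lam) (ModalFormula.chainSet p) := fun Θ =>
    not_satisfiableOn_chainSet (fun y => genIcard_le _ _ _ (isOpen_leftTopology_Iic y)) hκ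
      (completelyCovered_nhds_genIcard (fun S _ hS => isOpen_leftTopology_sInter S hS) hκ hlam)
      hI p
  have hclub : ∀ Θ : Ordinal.{u},
      ¬ ModalFormula.SatisfiableOn (genIcard (clubTopology Θ) lam) (ModalFormula.chainSet p) :=
    fun Θ => not_satisfiableOn_chainSet (fun y => genIcard_le _ _ _ (isOpen_clubTopology_Iic y)) hκ
      (completelyCovered_nhds_genIcard isOpen_clubTopology_sInter hκ hlam) hI p
  refine ⟨hcons, hleft, hclub, fun K hK hsc => ?_⟩
  obtain ⟨S, hS, hsat⟩ := hsc _ hcons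
  obtain ⟨Θ, rfl | rfl⟩ := hK S hS
  exacts [hleft Θ hsat, hclub Θ hsat]
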